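/- Colours are the elements of $\Gamma=\{0>1>2>\cdots\}$. A coloured permutation is a finite (possibly empty) string $\boldsymbol a=\sigma_1^{\gamma_1}\cdots\sigma_n^{\gamma_n}$ with distinct positive integers $\sigma_1,\dots,\sigma_n$ (the symbols) and arbitrary colours $\gamma_1,\dots,\gamma_n\in\Gamma$; write $|\boldsymbol a|=n$. Coloured positive integers are totally ordered by $\sigma^{\gamma}<\tau^{\delta}$ if and only if $\gamma>\delta$ in $\mathbb Z$, or $\gamma=\delta$ and $\sigma<\tau$. Let $\mathrm{Des}(\boldsymbol a)\subseteq\{0,\dots,n-1\}$ consist of all $i\in\{1,\dots,n-1\}$ with $\sigma_i^{\gamma_i}>\sigma_{i+1}^{\gamma_{i+1}}$, together with $0$ if $n\ge 1$ and $\gamma_1\neq 0$. Let $\mathrm{des}(\boldsymbol a)=|\mathrm{Des}(\boldsymbol a)|$ and $\mathrm{comaj}(\boldsymbol a)=\sum_{i\in\mathrm{Des}(\boldsymbol a)}(n-i)$. A coloured configuration is a formal sum $f=\sum_{\boldsymbol a}f_{\boldsymbol a}\boldsymbol a$ over all coloured permutations with $f_{\boldsymbol a}\in\mathbb N_0$,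 almost all zero; $\mathrm{supp}(f)=\{\boldsymbol a: f_{\boldsymbol a}\ne 0\}$, and $\mathrm{pal}^*(f)$ is the set of nonzero colours occurring in elements of $\mathrm{supp}(f)$. Let $\mathbb U=\{\pm X^k:k\in\mathbb Z\}\subset\mathbb Q(X)^\times$. A labelled coloured configuration is a pair $(f,\alpha)$ of a coloured configuration $f$ and a function $\alpha\colon\Gamma\to\mathbb U$ with $\{c\in\Gamma:\alpha(c)\neq1\}\subseteq\mathrm{pal}^*(f)$. Put $\alpha(\boldsymbol a)=\prod_{i=1}^n\alpha(\gamma_i)$ and, for $\varepsilon\in\mathbb Z$, $$W^{\varepsilon}_{f,\alpha}=\sum_{\boldsymbol a\in\mathrm{supp}(f)}f_{\boldsymbol a}\,\frac{\alpha(\boldsymbol a)\,X^{\varepsilon\,\mathrm{comaj}(\boldsymbol a)}\,Y^{\mathrm{des}(\boldsymbol a)}}{(1-Y)(1-X^{\varepsilon}Y)\cdots(1-X^{\varepsilon|\boldsymbol a|}Y)}\in\mathbb Q(X)[[Y]].$$ The Hadamard product of $A=\sum_k a_kY^k$ and $B=\sum_k b_kY^k$ is $A*_YB=\sum_k a_kb_kY^k$.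 **Corollary.** Let $\varepsilon\in\mathbb Z$ be fixed. Then the set $\{W^{\varepsilon}_{f,\alpha}:(f,\alpha)\text{ is a labelled coloured configuration}\}$ is closed under Hadamard products in $Y$: for all labelled coloured configurations $(f,\alpha)$ and $(g,\beta)$ there is a labelled coloured configuration $(h,\delta)$ with $W^{\varepsilon}_{f,\alpha}*_YW^{\varepsilon}_{g,\beta}=W^{\varepsilon}_{h,\delta}$. -/

import Mathlib

namespace ColouredConfig

/-- Colours: the poset `Γ = {0 > 1 > 2 > ⋯}`. -/
abbrev Colour : Type := ℕᵒᵈ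

/-- The colour `0`, the largest element of `Γ`. -/
def colourZero : Colour := OrderDual.toDual 0

/-- Coloured positive integers `σ^γ`, stored as pairs `(γ, σ)`, with the colour order, i.e. the
left lexicographic order on `Γ × Σ`, where `Σ = {1 < 2 < ⋯}`. -/
abbrev Letter : Type := ℕᵒᵈ ×ₗ ℕ+

/-- The symbol `σ` of the coloured positive integer `σ^γ`. -/
def Letter.symbol (x : Letter) : ℕ+ := (ofLex x).2

/-- The colour `γ` of the coloured positive integer `σ^γ`. -/
def Letter.colour (x : Letter) : Colour := (ofLex x).1

/-- A coloured permutation: a finite string of coloured positive integers whose symbols are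
pairwise distinct (symbols need not be `1, …, n`; the empty string is allowed). -/
structure ColouredPerm where
  word : List Letter
  nodup : (word.map Letter.symbol).Nodup

namespace ColouredPerm

/-- The length `|a|`. -/
def length (a : ColouredPerm) : ℕ := a.word.length

/-- The set of colours occurring in `a`. -/
def palette (a : ColouredPerm) : Set Colour := {c | ∃ x ∈ a.word, Letter.colour x = c}

/-- The set of nonzero colours occurring in `a`. -/
def paletteStar (a : ColouredPerm) : Set Colour := a.palette \ {colourZero}

/-- The descent set of `a = a_1 ⋯ a_n`, a subset of `{0, …, n - 1}`: it contains `0` iff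
the colour of `a_1` is nonzero, and `i ≥ 1` iff `a_i > a_{i+1}` in the colour order. Note that
`a_i` is the entry of the list `a.word` at position `i - 1`. -/
def descentSet (a : ColouredPerm) : Finset (Fin a.word.length) :=
  Finset.univ.filter fun i =>
    ((i : ℕ) = 0 ∧ Letter.colour a.word[(i : ℕ)] ≠ colourZero) ∨
      (1 ≤ (i : ℕ) ∧ a.word[(i : ℕ)] < a.word[(i : ℕ) - 1])

/-- The descent number `des(a) = |Des(a)|`. -/
def des (a : ColouredPerm) : ℕ := a.descentSet.card

/-- The comajor index `comaj(a) = ∑_{i ∈ Des(a)} (n - i)`, where `n = |a|`. -/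
def comaj (a : ColouredPerm) : ℕ := ∑ i ∈ a.descentSet, (a.length - (i : ℕ))

end ColouredPerm

/-- Coloured configurations: the free commutative monoid `ℕ₀𝒜` on the set `𝒜` of all coloured
permutations. -/
abbrev Configuration : Type := ColouredPerm →₀ ℕ

/-- The set of nonzero colours occurring in members of the support of `f`. -/
def Configuration.paletteStar (f : Configuration) : Set Colour :=
  ⋃ a ∈ f.support, ColouredPerm.paletteStar a

/-- The group `𝕌 = {± X ^ k : k ∈ ℤ}` of units of the field `ℚ(X)`. -/
def labelGroup : Subgroup (RatFunc ℚ)ˣ where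
  carrier := {u | ∃ k : ℤ, (u : RatFunc ℚ) = RatFunc.X ^ k ∨ (u : RatFunc ℚ) = -RatFunc.X ^ k}
  one_mem' := ⟨0, Or.inl (by simp)⟩
  mul_mem' := by
    rintro u v ⟨k, hk⟩ ⟨l, hl⟩
    refine ⟨k + l, ?_⟩
    rw [Units.val_mul, zpow_add₀ RatFunc.X_ne_zero]
    rcases hk with hk | hk <;> rcases hl with hl | hl <;> simp [hk, hl]
  inv_mem' := by
    rintro u ⟨k, hk⟩
    refine ⟨-k, ?_⟩
    rw [Units.val_inv_eq_inv_val, zpow_neg]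
    rcases hk with hk | hk <;> simp [hk, inv_neg]

/-- A labelled coloured configuration `(f, α)`: a coloured configuration `f` and a function
`α : Γ → 𝕌` with `{c : α c ≠ 1}` contained in the set of nonzero colours occurring in `f`. -/
structure LabelledConfiguration where
  f : Configuration
  α : Colour → labelGroup
  supp_subset : {c | α c ≠ 1} ⊆ Configuration.paletteStar f

/-- `α(a) = α(γ_1) ⋯ α(γ_n)` for `a = σ_1^{γ_1} ⋯ σ_n^{γ_n}`, as an element of `ℚ(X)`. -/
noncomputable def labelProd (α : Colour → labelGroup) (a : ColouredPerm) : RatFunc ℚ :=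
  (((a.word.map fun x => α (Letter.colour x)).prod : (RatFunc ℚ)ˣ) : RatFunc ℚ)

/-- The denominator `(1 - Y)(1 - X^ε Y) ⋯ (1 - X^{ε n} Y)` in `ℚ(X)⟦Y⟧`. -/
noncomputable def denominator (ε : ℤ) (n : ℕ) : PowerSeries (RatFunc ℚ) :=
  ∏ i ∈ Finset.range (n + 1),
    (1 - PowerSeries.C ((RatFunc.X : RatFunc ℚ) ^ (ε * (i : ℤ))) * PowerSeries.X)

/-- The denominator has constant term `1`, so that its inverse in `W` is a genuine inverse. -/
theorem constantCoeff_denominator (ε : ℤ) (n : ℕ) :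
    PowerSeries.constantCoeff (denominator ε n) = 1 := by
  simp [denominator, map_prod]

/-- The formal power series `W^ε_{f,α}(X, Y)` in `ℚ(X)⟦Y⟧`. -/
noncomputable def W (ε : ℤ) (F : LabelledConfiguration) : PowerSeries (RatFunc ℚ) :=
  ∑ a ∈ F.f.support,
    (F.f a : PowerSeries (RatFunc ℚ)) *
      (PowerSeries.C (labelProd F.α a * RatFunc.X ^ (ε * (a.comaj : ℤ))) *
        PowerSeries.X ^ a.des * (denominator ε a.length)⁻¹)

/-- The Hadamard product of two formal power series: the coefficientwise product. -/
noncomputable def hadamard {R : Type*} [CommRing R] (A B : PowerSeries R) : PowerSeries R :=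
  PowerSeries.mk fun k => PowerSeries.coeff k A * PowerSeries.coeff k B

end ColouredConfig

/-! Put q = X^ε. The coefficient of Y^k in the term of W belonging to a word a is, up to its label,
the sum of q^(m₁ + ⋯ + mₙ) over levels mᵢ ≤ k for which the pairs (mᵢ, aᵢ) increase
lexicographically from (0, 1^0): a descent of a forces the level to rise strictly
(`chainSum_eq_coeff`). Two such chains on words without a common letter merge uniquely into one
chain on a shuffle, so multiplying coefficients amounts to summing over shuffles (`chainSum_mul`).

Words are made disjoint by even and odd relabelling of symbols and nonzero colours. This preserves
the order and the role of colour 0, hence the chain sums (`chainSum_map`). As the nonzero colours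
also become disjoint, one labelling restricts to both given ones; on the shared colour 0 both are
trivial (`LabelledConfiguration.α_zero`). -/

namespace ColouredConfig

/-! ### Shuffles of words -/

section Shuffle

variable {L : Type*}

/-- All shuffles of two words, with multiplicity. -/
def shuffles : List L → List L → List (List L)
  | [], v => [v]
  | x :: u, [] => [x :: u]
  | x :: u, y :: v =>
      (shuffles u (y :: v)).map (x :: ·) ++ (shuffles (x :: u) v).map (y :: ·)
termination_by u v => u.length + v.length

theorem perm_of_mem_shuffles (u v c : List L) (h : c ∈ shuffles u v) : c.Perm (u ++ v) := by
  fun_induction shuffles u v generalizing c with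
  | case1 v => simp_all
  | case2 x u => simp_all
  | case3 x u y v ih₁ ih₂ =>
    simp only [List.mem_append, List.mem_map] at h
    rcases h with ⟨d, hd, rfl⟩ | ⟨d, hd, rfl⟩
    · exact (ih₁ d hd).cons x
    · exact ((ih₂ d hd).cons y).trans List.perm_middle.symm

theorem shuffles_ne_nil (u v : List L) : shuffles u v ≠ [] := by
  fun_induction shuffles u v <;> simp_all

end Shuffle

/-! ### Chain sums and their generating functions -/

section ChainSum

variable {L K : Type*} [LinearOrder L] [Field K]

/-- The generating function of the levels `m₁, …, mₙ ≤ k` for which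
`s ≤ (m₁, w₁) ≤ ⋯ ≤ (mₙ, wₙ)` in the lexicographic order. -/
def chainSum (q : K) (k : ℕ) : ℕ ×ₗ L → List L → K
  | _, [] => 1
  | s, x :: w => ∑ m ∈ Finset.range (k + 1),
      if s ≤ toLex (m, x) then q ^ m * chainSum q k (toLex (m, x)) w else 0

/-- The product of two chain sums is the sum over all shuffles: in a pair of chains the smaller
of the two first elements is the first element of the merged chain. -/
theorem chainSum_mul (q : K) (k : ℕ) (u v : List L) (h : u.Disjoint v) (s : ℕ ×ₗ L) :
    chainSum q k s u * chainSum q k s v = ((shuffles u v).map (chainSum q k s)).sum := by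
  fun_induction shuffles u v generalizing s with
  | case1 v => simp [chainSum]
  | case2 x u => simp [chainSum]
  | case3 x u y v ih₁ ih₂ =>
    have hxy : x ≠ y := by rintro rfl; exact h List.mem_cons_self List.mem_cons_self
    have ih₁ := ih₁ (fun a ha hb => h (List.mem_cons_of_mem _ ha) hb)
    have ih₂ := ih₂ (fun a ha hb => h ha (List.mem_cons_of_mem _ hb))
    have key : ∀ (z : L) (l : List (List L)),
        (l.map (fun c => chainSum q k s (z :: c))).sum = ∑ m ∈ Finset.range (k + 1),
          if s ≤ toLex (m, z) then q ^ m * (l.map (chainSum q k (toLex (m, z)))).sum else 0 := by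
      intro z l
      induction l with
      | nil => simp
      | cons a l ih =>
        rw [List.map_cons, List.sum_cons, ih, chainSum, ← Finset.sum_add_distrib]
        refine Finset.sum_congr rfl fun m _ => ?_
        split_ifs <;> simp [mul_add]
    rw [List.map_append, List.sum_append, List.map_map, List.map_map]
    simp only [Function.comp_def]
    rw [key, key]
    simp only [← ih₁, ← ih₂]
    simp only [chainSum, Finset.sum_mul_sum]
    simp only [Finset.mul_sum, Finset.sum_mul]
    -- The two heads never tie, because x ≠ y. The bound s on the larger head follows by
    -- transitivity from the bound on the smaller one.
    have e : ∀ m₁ m₂ : ℕ,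
        ((if s ≤ toLex (m₁, x) then q ^ m₁ * chainSum q k (toLex (m₁, x)) u else 0) *
          (if s ≤ toLex (m₂, y) then q ^ m₂ * chainSum q k (toLex (m₂, y)) v else 0)) =
        (if s ≤ toLex (m₁, x) then q ^ m₁ * (chainSum q k (toLex (m₁, x)) u *
          (if toLex (m₁, x) ≤ toLex (m₂, y) then
            q ^ m₂ * chainSum q k (toLex (m₂, y)) v else 0)) else 0) +
        (if s ≤ toLex (m₂, y) then q ^ m₂ * (
          (if toLex (m₂, y) ≤ toLex (m₁, x) then
            q ^ m₁ * chainSum q k (toLex (m₁, x)) u else 0) *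
              chainSum q k (toLex (m₂, y)) v) else 0) := by
      intro m₁ m₂
      have hne : toLex (m₁, x) ≠ toLex (m₂, y) := fun h => hxy (congrArg (fun z => (ofLex z).2) h)
      rcases lt_or_gt_of_ne hne with hlt | hlt
      · have := hlt.not_ge
        by_cases h1 : s ≤ toLex (m₁, x)
        · simp [h1, hlt.le, this, h1.trans hlt.le]; ring
        · simp [h1, this]
      · have := hlt.not_ge
        by_cases h1 : s ≤ toLex (m₂, y)
        · simp [h1, hlt.le, this, h1.trans hlt.le]; ring
        · simp [h1, this]
    simp only [e, Finset.sum_add_distrib]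
    congr 1
    · refine Finset.sum_congr rfl fun m₁ _ => ?_
      split_ifs <;> simp
    · rw [Finset.sum_comm]
      refine Finset.sum_congr rfl fun m₁ _ => ?_
      split_ifs <;> simp

/-- The bounds need not correspond under φ: `evenLetter` does not fix `letterOne`. After the first
letter, monotonicity of φ supplies the comparison. -/
theorem chainSum_map {L' : Type*} [LinearOrder L'] (q : K) (k : ℕ) {φ : L → L'}
    (hφ : StrictMono φ) (w : List L) (m : ℕ) {p : L} {p' : L'}
    (hp : ∀ x, p' ≤ φ x ↔ p ≤ x) :
    chainSum q k (toLex (m, p')) (w.map φ) = chainSum q k (toLex (m, p)) w := by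
  induction w generalizing m p p' with
  | nil => simp [chainSum]
  | cons x w ih =>
    simp only [List.map_cons, chainSum, Prod.Lex.toLex_le_toLex, hp]
    refine Finset.sum_congr rfl fun i _ => ?_
    rw [ih i (fun y => hφ.le_iff_le)]

/-- The number of descents of the word `p w`. -/
def wordDes : L → List L → ℕ
  | _, [] => 0
  | p, x :: w => (if x < p then 1 else 0) + wordDes x w

/-- The comajor index of `w`, with the letter `p` put in front of it. -/
def wordComaj : L → List L → ℕ
  | _, [] => 0
  | p, x :: w => (if x < p then w.length + 1 else 0) + wordComaj x w

theorem sum_fin_wordDes (p : L) (w : List L) :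
    (∑ i : Fin w.length, if w[(i : ℕ)] < (p :: w)[(i : ℕ)]'(by simp) then 1 else 0)
      = wordDes p w := by
  induction w generalizing p with
  | nil => simp [wordDes]
  | cons x w ih =>
    simp only [List.length_cons, Fin.sum_univ_succ, wordDes, ← ih]
    simp
    rfl

theorem sum_fin_wordComaj (p : L) (w : List L) :
    (∑ i : Fin w.length, if w[(i : ℕ)] < (p :: w)[(i : ℕ)]'(by simp)
      then w.length - (i : ℕ) else 0) = wordComaj p w := by
  induction w generalizing p with
  | nil => simp [wordComaj]
  | cons x w ih =>
    simp only [List.length_cons, Fin.sum_univ_succ, wordComaj, ← ih]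
    simp

/-- The product `(1 - Y)(1 - q Y) ⋯ (1 - q ^ n Y)`. -/
noncomputable def qDenominator (q : K) (n : ℕ) : PowerSeries K :=
  ∏ i ∈ Finset.range (n + 1), (1 - PowerSeries.C (q ^ i) * PowerSeries.X)

theorem constantCoeff_qDenominator (q : K) (n : ℕ) :
    PowerSeries.constantCoeff (qDenominator q n) = 1 := by
  simp [qDenominator, map_prod]

/-- The geometric series in rY, without its constant term if P holds. It will count the rise in
level at one letter, with P saying that there is a descent. -/
theorem mk_mul_one_sub (r : K) (P : Prop) [Decidable P] :
    PowerSeries.mk (fun i => if 0 < i ∨ ¬ P then r ^ i else 0) *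
      (1 - PowerSeries.C r * PowerSeries.X) = if P then PowerSeries.C r * PowerSeries.X else 1 := by
  ext n
  rw [mul_sub, mul_one, ← mul_assoc, mul_comm _ (PowerSeries.C r), mul_assoc]
  by_cases hP : P
  · rcases n with _ | _ | n <;>
      simp [hP, PowerSeries.coeff_X, pow_succ, mul_comm]
  · rcases n with _ | n <;>
      simp [hP, PowerSeries.coeff_one, pow_succ, mul_comm]

/-- Induction on the word, recording the rise i = m - j at its first letter. A rise lifts all
remaining levels at once, so it has weight q^(i * length), and it may be 0 only if there is no
descent. -/
theorem chainSum_eq_coeff (q : K) (k : ℕ) (w : List L) (p : L) (j : ℕ) (hj : j ≤ k) :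
    chainSum q k (toLex (j, p)) w = q ^ (j * w.length) *
      PowerSeries.coeff (k - j) (PowerSeries.C (q ^ wordComaj p w) *
        PowerSeries.X ^ wordDes p w * (qDenominator q w.length)⁻¹) := by
  induction w generalizing p j with
  | nil =>
    have : (qDenominator q 0)⁻¹ = PowerSeries.mk (fun _ => (1 : K)) := by
      rw [PowerSeries.inv_eq_iff_mul_eq_one (by simp [constantCoeff_qDenominator])]
      simpa [qDenominator] using mk_mul_one_sub (1 : K) False
    simp [chainSum, wordComaj, wordDes, this]
  | cons x w ih =>
    have hd : PowerSeries.C (q ^ wordComaj p (x :: w)) * PowerSeries.X ^ wordDes p (x :: w) *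
          (qDenominator q (w.length + 1))⁻¹ =
        PowerSeries.mk (fun i => if 0 < i ∨ ¬ x < p then (q ^ (w.length + 1)) ^ i else 0) *
        (PowerSeries.C (q ^ wordComaj x w) * PowerSeries.X ^ wordDes x w *
          (qDenominator q w.length)⁻¹) := by
      rw [eq_comm, PowerSeries.eq_mul_inv_iff_mul_eq (by simp [constantCoeff_qDenominator])]
      have h1 : qDenominator q (w.length + 1) = qDenominator q w.length *
          (1 - PowerSeries.C (q ^ (w.length + 1)) * PowerSeries.X) := by
        rw [qDenominator, Finset.prod_range_succ]; rfl
      have h2 : (qDenominator q w.length)⁻¹ * qDenominator q w.length = 1 :=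
        PowerSeries.inv_mul_cancel _ (by simp [constantCoeff_qDenominator])
      have h3 := mk_mul_one_sub (q ^ (w.length + 1)) (x < p)
      rw [h1]
      calc _ = (PowerSeries.mk (fun i => if 0 < i ∨ ¬ x < p then (q ^ (w.length + 1)) ^ i else 0) *
              (1 - PowerSeries.C (q ^ (w.length + 1)) * PowerSeries.X)) *
            (PowerSeries.C (q ^ wordComaj x w) * PowerSeries.X ^ wordDes x w) *
            ((qDenominator q w.length)⁻¹ * qDenominator q w.length) := by ring
        _ = _ := by
          rw [h2, h3, wordComaj, wordDes]
          split_ifs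
          · rw [pow_add q (w.length + 1), pow_add PowerSeries.X, map_mul, pow_one]; ring
          · simp
    rw [List.length_cons, hd, PowerSeries.coeff_mul, Finset.Nat.sum_antidiagonal_eq_sum_range_succ
      (fun a b => PowerSeries.coeff a (PowerSeries.mk _) * PowerSeries.coeff b _), chainSum,
      Finset.mul_sum]
    -- Levels below j violate the bound and contribute zero; the others are m = j + i.
    have hsplit : k + 1 = j + (k - j).succ := by omega
    rw [hsplit, Finset.sum_range_add, Finset.sum_eq_zero, zero_add]
    · refine Finset.sum_congr rfl fun i hi => ?_
      have hi' : j + i ≤ k := by have := Finset.mem_range.1 hi; omega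
      rw [ih x (j + i) hi', PowerSeries.coeff_mk, Nat.sub_add_eq]
      have : toLex (j, p) ≤ toLex (j + i, x) ↔ 0 < i ∨ ¬ x < p := by
        simp only [Prod.Lex.toLex_le_toLex, not_lt]
        rcases Nat.eq_zero_or_pos i with rfl | h
        · simp
        · simp [h]
      simp only [this]
      split_ifs
      · rw [← mul_assoc, ← mul_assoc, ← pow_add, ← pow_mul, ← pow_add]
        congr 2
        ring
      · simp
    · intro i hi
      rw [if_neg]
      have := Finset.mem_range.1 hi
      simp only [Prod.Lex.toLex_le_toLex]
      omega

end ChainSum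

/-! ### Descents and coefficients of `W` -/

/-- The letter `1^0`, the least one of colour `0`. -/
def letterOne : Letter := toLex (colourZero, 1)

/-- Lets `letterOne` act as a sentinel: placed in front of a word, it turns the condition for a
descent at 0 into an ordinary descent. -/
theorem lt_letterOne_iff (x : Letter) : x < letterOne ↔ x.colour ≠ colourZero := by
  have h : x.colour ≤ colourZero := Nat.zero_le _
  rw [letterOne, ← toLex_ofLex x, Prod.Lex.toLex_lt_toLex]
  change x.colour < colourZero ∨ x.colour = colourZero ∧ _ < (1 : ℕ+) ↔ _
  simp [lt_iff_le_and_ne, h]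

namespace ColouredPerm

theorem mem_descentSet_iff (a : ColouredPerm) (i : Fin a.word.length) :
    i ∈ a.descentSet ↔
      a.word[(i : ℕ)] < (letterOne :: a.word)[(i : ℕ)]'(by simp) := by
  obtain ⟨i, hi⟩ := i
  rcases i with _ | i <;> simp [descentSet, lt_letterOne_iff]

theorem des_eq (a : ColouredPerm) : a.des = wordDes letterOne a.word := by
  rw [← sum_fin_wordDes, ← Finset.card_filter, des]
  congr 1
  ext i
  simp [mem_descentSet_iff]

theorem comaj_eq (a : ColouredPerm) : a.comaj = wordComaj letterOne a.word := by
  rw [← sum_fin_wordComaj, ← Finset.sum_filter, comaj]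
  refine Finset.sum_congr ?_ fun _ _ => rfl
  ext i
  simp [mem_descentSet_iff]

end ColouredPerm

theorem denominator_eq (ε : ℤ) (n : ℕ) :
    denominator ε n = qDenominator ((RatFunc.X : RatFunc ℚ) ^ ε) n := by
  simp [denominator, qDenominator, zpow_mul]

theorem coeff_W (ε : ℤ) (F : LabelledConfiguration) (k : ℕ) :
    PowerSeries.coeff k (W ε F) = F.f.sum fun a n => (n : RatFunc ℚ) * (labelProd F.α a *
      chainSum (RatFunc.X ^ ε : RatFunc ℚ) k (toLex (0, letterOne)) a.word) := by
  rw [W, map_sum, Finsupp.sum]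
  refine Finset.sum_congr rfl fun a _ => ?_
  rw [chainSum_eq_coeff _ _ _ _ _ (Nat.zero_le k), a.des_eq, a.comaj_eq, denominator_eq,
    ← map_natCast (PowerSeries.C (R := RatFunc ℚ)), PowerSeries.coeff_C_mul,
    (PowerSeries.C (R := RatFunc ℚ)).map_mul, mul_assoc, mul_assoc, PowerSeries.coeff_C_mul,
    zpow_mul, zpow_natCast]
  simp [ColouredPerm.length, mul_assoc]

/-! ### Making two words disjoint -/

/-- Make all colours and all symbols even, keeping the colour `0`. -/
def evenLetter (x : Letter) : Letter :=
  toLex (OrderDual.toDual (2 * OrderDual.ofDual x.colour), 2 * x.symbol)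

/-- Make all nonzero colours and all symbols odd, keeping the colour `0`. -/
def oddLetter (x : Letter) : Letter :=
  toLex (OrderDual.toDual (2 * OrderDual.ofDual x.colour - 1),
    ⟨2 * x.symbol - 1, by have := x.symbol.pos; omega⟩)

theorem Letter.lt_iff (x y : Letter) : x < y ↔
    OrderDual.ofDual y.colour < OrderDual.ofDual x.colour ∨
      OrderDual.ofDual x.colour = OrderDual.ofDual y.colour ∧
        (x.symbol : ℕ) < (y.symbol : ℕ) := by
  rw [← toLex_ofLex x, ← toLex_ofLex y, Prod.Lex.toLex_lt_toLex]
  rfl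

theorem strictMono_evenLetter : StrictMono evenLetter := by
  intro x y h
  rw [Letter.lt_iff] at h ⊢
  simp only [evenLetter, Letter.colour, Letter.symbol, ofLex_toLex, OrderDual.ofDual_toDual,
    PNat.mul_coe, PNat.val_ofNat] at h ⊢
  omega

/-- Truncated subtraction sends the colours 0, 1, 2, … to 0, 1, 3, …, still strictly increasing as
naturals. -/
theorem strictMono_oddLetter : StrictMono oddLetter := by
  intro x y h
  rw [Letter.lt_iff] at h ⊢
  have := x.symbol.pos
  have := y.symbol.pos
  simp only [oddLetter, Letter.colour, Letter.symbol, ofLex_toLex, OrderDual.ofDual_toDual,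
    PNat.mk_coe] at *
  omega

theorem colour_eq_zero_iff (x : Letter) :
    x.colour = colourZero ↔ OrderDual.ofDual x.colour = 0 := Iff.rfl

theorem letterOne_le_evenLetter (x : Letter) : letterOne ≤ evenLetter x ↔ letterOne ≤ x := by
  rw [← not_lt, ← not_lt, lt_letterOne_iff, lt_letterOne_iff, not_ne_iff, not_ne_iff,
    colour_eq_zero_iff, colour_eq_zero_iff]
  simp only [evenLetter, Letter.colour, ofLex_toLex, OrderDual.ofDual_toDual]
  omega

theorem letterOne_le_oddLetter (x : Letter) : letterOne ≤ oddLetter x ↔ letterOne ≤ x := by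
  rw [← not_lt, ← not_lt, lt_letterOne_iff, lt_letterOne_iff, not_ne_iff, not_ne_iff,
    colour_eq_zero_iff, colour_eq_zero_iff]
  simp only [oddLetter, Letter.colour, ofLex_toLex, OrderDual.ofDual_toDual]
  omega

theorem symbol_evenLetter_ne (x y : Letter) :
    (evenLetter x).symbol ≠ (oddLetter y).symbol := by
  intro h
  have := congrArg PNat.val h
  have := y.symbol.pos
  simp only [evenLetter, oddLetter, Letter.symbol, ofLex_toLex, PNat.mul_coe, PNat.val_ofNat,
    PNat.mk_coe] at *
  omega

theorem symbol_evenLetter_inj {x y : Letter} (h : (evenLetter x).symbol = (evenLetter y).symbol) :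
    x.symbol = y.symbol := by
  have := congrArg PNat.val h
  apply PNat.eq
  simp only [evenLetter, Letter.symbol, ofLex_toLex, PNat.mul_coe, PNat.val_ofNat] at *
  omega

theorem symbol_oddLetter_inj {x y : Letter} (h : (oddLetter x).symbol = (oddLetter y).symbol) :
    x.symbol = y.symbol := by
  have := congrArg PNat.val h
  have := x.symbol.pos
  have := y.symbol.pos
  apply PNat.eq
  simp only [oddLetter, Letter.symbol, ofLex_toLex, PNat.mk_coe] at *
  omega

/-! ### Shuffles of coloured configurations -/

/-- The shuffles of the words of `a` and `b`, made disjoint. -/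
def shuffleWords (a b : ColouredPerm) : List (List Letter) :=
  shuffles (a.word.map evenLetter) (b.word.map oddLetter)

theorem perm_of_mem_shuffleWords {a b : ColouredPerm} {c : List Letter}
    (h : c ∈ shuffleWords a b) : c.Perm (a.word.map evenLetter ++ b.word.map oddLetter) :=
  perm_of_mem_shuffles _ _ _ h

theorem nodup_of_mem_shuffleWords {a b : ColouredPerm} {c : List Letter}
    (h : c ∈ shuffleWords a b) : (c.map Letter.symbol).Nodup := by
  rw [((perm_of_mem_shuffleWords h).map Letter.symbol).nodup_iff, List.map_append,
    List.nodup_append]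
  refine ⟨?_, ?_, ?_⟩
  · have ha := a.nodup
    rw [List.Nodup, List.pairwise_map] at ha
    rw [List.map_map, List.Nodup, List.pairwise_map]
    exact ha.imp fun hne h => hne (symbol_evenLetter_inj h)
  · have hb := b.nodup
    rw [List.Nodup, List.pairwise_map] at hb
    rw [List.map_map, List.Nodup, List.pairwise_map]
    exact hb.imp fun hne h => hne (symbol_oddLetter_inj h)
  · simp only [List.mem_map]
    rintro _ ⟨_, ⟨x, -, rfl⟩, rfl⟩ _ ⟨_, ⟨y, -, rfl⟩, rfl⟩
    exact symbol_evenLetter_ne x y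

/-- The sum of the shuffles of `a` and `b`, made disjoint. -/
noncomputable def shuffleConfiguration (a b : ColouredPerm) : Configuration :=
  ((shuffleWords a b).attach.map fun c =>
    Finsupp.single (⟨c.1, nodup_of_mem_shuffleWords c.2⟩ : ColouredPerm) 1).sum

theorem exists_mem_support_shuffleConfiguration (a b : ColouredPerm) :
    ∃ e : ColouredPerm, shuffleConfiguration a b e ≠ 0 ∧
      e.word.Perm (a.word.map evenLetter ++ b.word.map oddLetter) := by
  obtain ⟨c, hc⟩ := List.exists_mem_of_ne_nil _
    (shuffles_ne_nil (a.word.map evenLetter) (b.word.map oddLetter))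
  refine ⟨⟨c, nodup_of_mem_shuffleWords hc⟩, ?_, perm_of_mem_shuffleWords hc⟩
  have hle : Finsupp.single (⟨c, nodup_of_mem_shuffleWords hc⟩ : ColouredPerm) 1 ≤
      shuffleConfiguration a b :=
    List.single_le_sum (fun _ _ => zero_le) _
      (List.mem_map.2 ⟨⟨c, hc⟩, List.mem_attach _ _, rfl⟩)
  have := hle ⟨c, nodup_of_mem_shuffleWords hc⟩
  rw [Finsupp.single_eq_same] at this
  omega

theorem perm_of_mem_support_shuffleConfiguration {a b e : ColouredPerm}
    (he : shuffleConfiguration a b e ≠ 0) :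
    e.word.Perm (a.word.map evenLetter ++ b.word.map oddLetter) := by
  have h : ∀ l : List {c // c ∈ shuffleWords a b},
      ((l.map fun c => Finsupp.single
        (⟨c.1, nodup_of_mem_shuffleWords c.2⟩ : ColouredPerm) 1).sum : Configuration) e ≠ 0 →
      e.word ∈ shuffleWords a b := by
    intro l
    induction l with
    | nil => simp
    | cons c l ih =>
      intro hne
      rw [List.map_cons, List.sum_cons, Finsupp.add_apply] at hne
      by_cases hc : (⟨c.1, nodup_of_mem_shuffleWords c.2⟩ : ColouredPerm) = e
      · rw [← hc]; exact c.2
      · rw [Finsupp.single_eq_of_ne (Ne.symm hc), zero_add] at hne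
        exact ih hne
  exact perm_of_mem_shuffleWords (h _ he)

/-- The bilinear extension of `shuffleConfiguration`. -/
noncomputable def shuffleProduct (f g : Configuration) : Configuration :=
  ∑ a ∈ f.support, ∑ b ∈ g.support, (f a * g b) • shuffleConfiguration a b

theorem sum_shuffleProduct {K : Type*} [Field K] (f g : Configuration) (t : ColouredPerm → K) :
    ((shuffleProduct f g).sum fun c n => (n : K) * t c) =
      ∑ a ∈ f.support, ∑ b ∈ g.support, ((f a : K) * (g b : K)) *
        ((shuffleConfiguration a b).sum fun c n => (n : K) * t c) := by
  have h0 : ∀ c : ColouredPerm, ((0 : ℕ) : K) * t c = 0 := by simp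
  have h1 : ∀ (c : ColouredPerm) (m n : ℕ),
      ((m + n : ℕ) : K) * t c = (m : K) * t c + (n : K) * t c := by
    intro c m n; push_cast; ring
  rw [shuffleProduct, ← Finsupp.sum_finsetSum_index h0 h1]
  refine Finset.sum_congr rfl fun a _ => ?_
  rw [← Finsupp.sum_finsetSum_index h0 h1]
  refine Finset.sum_congr rfl fun b _ => ?_
  rw [Finsupp.sum_smul_index h0, Finsupp.mul_sum]
  refine Finsupp.sum_congr fun c _ => ?_
  push_cast
  ring

theorem sum_shuffleConfiguration {K : Type*} [Field K] (a b : ColouredPerm)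
    (t : List Letter → K) :
    ((shuffleConfiguration a b).sum fun c n => (n : K) * t c.word) =
      ((shuffleWords a b).map t).sum := by
  have h : ∀ l : List {c // c ∈ shuffleWords a b},
      (((l.map fun c => Finsupp.single
        (⟨c.1, nodup_of_mem_shuffleWords c.2⟩ : ColouredPerm) 1).sum : Configuration).sum
          fun c n => (n : K) * t c.word) = (l.map fun c => t c.1).sum := by
    intro l
    induction l with
    | nil => simp
    | cons c l ih =>
      rw [List.map_cons, List.sum_cons, Finsupp.sum_add_index' (by simp)
        (by intros; push_cast; ring), ih, Finsupp.sum_single_index (by simp)]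
      simp
  rw [shuffleConfiguration, h, List.attach_map_val]

/-! ### Merging labels -/

/-- The labelling of even colours by `α` and of odd colours by `β`. -/
def mergeLabels (α β : Colour → labelGroup) (c : Colour) : labelGroup :=
  if Even (OrderDual.ofDual c) then α (OrderDual.toDual (OrderDual.ofDual c / 2))
  else β (OrderDual.toDual ((OrderDual.ofDual c + 1) / 2))

theorem mergeLabels_evenLetter (α β : Colour → labelGroup) (x : Letter) :
    mergeLabels α β (evenLetter x).colour = α x.colour := by
  simp [mergeLabels, evenLetter, Letter.colour]

theorem mergeLabels_oddLetter (α β : Colour → labelGroup) (hα : α colourZero = 1)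
    (hβ : β colourZero = 1) (x : Letter) :
    mergeLabels α β (oddLetter x).colour = β x.colour := by
  obtain ⟨c, hc⟩ : ∃ c : ℕ, x.colour = OrderDual.toDual c := ⟨_, rfl⟩
  have h : (oddLetter x).colour = OrderDual.toDual (2 * c - 1) := by
    rw [← OrderDual.ofDual_toDual c, ← hc]; rfl
  rw [h, hc]
  rcases c with _ | c
  -- Colour 0 is even, so it receives its label from α; both labels there are 1.
  · exact (if_pos (by simp)).trans (hα.trans hβ.symm)
  · rw [mergeLabels, if_neg, OrderDual.ofDual_toDual]
    · congr 2
      omega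
    · rw [OrderDual.ofDual_toDual, Nat.not_even_iff]
      omega

theorem LabelledConfiguration.α_zero (F : LabelledConfiguration) : F.α colourZero = 1 := by
  by_contra h
  have := F.supp_subset h
  simp [Configuration.paletteStar, ColouredPerm.paletteStar] at this

theorem labelProd_mergeLabels (F G : LabelledConfiguration) (a b c : ColouredPerm)
    (h : c.word.Perm (a.word.map evenLetter ++ b.word.map oddLetter)) :
    labelProd (mergeLabels F.α G.α) c = labelProd F.α a * labelProd G.α b := by
  have := (h.map fun x => mergeLabels F.α G.α (Letter.colour x)).prod_eq
  rw [labelProd, this]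
  simp [labelProd, List.map_map, Function.comp_def, mergeLabels_evenLetter,
    mergeLabels_oddLetter _ _ F.α_zero G.α_zero]

theorem mem_paletteStar_iff (f : Configuration) (c : Colour) :
    c ∈ Configuration.paletteStar f ↔
      c ≠ colourZero ∧ ∃ a : ColouredPerm, f a ≠ 0 ∧ ∃ x ∈ a.word, Letter.colour x = c := by
  simp [Configuration.paletteStar, ColouredPerm.paletteStar, ColouredPerm.palette]
  tauto

/-- Multiplicities are natural numbers, so nothing cancels in the sum. -/
theorem exists_mem_support_shuffleProduct {f g : Configuration} {a b : ColouredPerm}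
    (ha : f a ≠ 0) (hb : g b ≠ 0) : ∃ e : ColouredPerm, shuffleProduct f g e ≠ 0 ∧
      e.word.Perm (a.word.map evenLetter ++ b.word.map oddLetter) := by
  obtain ⟨e, he, hp⟩ := exists_mem_support_shuffleConfiguration a b
  refine ⟨e, fun h => ?_, hp⟩
  simp only [shuffleProduct, Finsupp.finsetSum_apply, Finset.sum_eq_zero_iff,
    Finsupp.mem_support_iff, Finsupp.smul_apply, smul_eq_mul, mul_eq_zero] at h
  have := h a ha b hb
  tauto

/-- A labelled configuration with underlying configuration `shuffleProduct F.f G.f`. -/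
noncomputable def LabelledConfiguration.shuffle (F G : LabelledConfiguration)
    (hF : F.f ≠ 0) (hG : G.f ≠ 0) : LabelledConfiguration where
  f := shuffleProduct F.f G.f
  α := mergeLabels F.α G.α
  supp_subset := by
    intro c hc
    have hz : c ≠ colourZero := by
      rintro rfl
      exact hc ((if_pos (by simp [colourZero])).trans F.α_zero)
    induction c using OrderDual.rec with | toDual n
    rw [mem_paletteStar_iff]
    refine ⟨hz, ?_⟩
    by_cases hn : Even n
    · have h1 : F.α (OrderDual.toDual (n / 2)) ≠ 1 := by
        intro h; exact hc ((if_pos hn).trans h)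
      obtain ⟨-, a, ha, x, hx, hxc⟩ := (mem_paletteStar_iff _ _).1 (F.supp_subset h1)
      -- Any word of G serves as partner; without one the colour would be lost from the product.
      obtain ⟨b, hb⟩ := Finsupp.ne_iff.1 hG
      obtain ⟨e, he, hp⟩ := exists_mem_support_shuffleProduct ha hb
      refine ⟨e, he, evenLetter x, hp.mem_iff.2 (List.mem_append.2 (Or.inl
        (List.mem_map_of_mem hx))), ?_⟩
      rw [Nat.even_iff] at hn
      change OrderDual.toDual (2 * OrderDual.ofDual x.colour) = _
      rw [hxc, OrderDual.ofDual_toDual]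
      congr 1
      omega
    · have h1 : G.α (OrderDual.toDual ((n + 1) / 2)) ≠ 1 := by
        intro h; exact hc ((if_neg hn).trans h)
      obtain ⟨-, b, hb, x, hx, hxc⟩ := (mem_paletteStar_iff _ _).1 (G.supp_subset h1)
      obtain ⟨a, ha⟩ := Finsupp.ne_iff.1 hF
      obtain ⟨e, he, hp⟩ := exists_mem_support_shuffleProduct ha hb
      refine ⟨e, he, oddLetter x, hp.mem_iff.2 (List.mem_append.2 (Or.inr
        (List.mem_map_of_mem hx))), ?_⟩
      rw [Nat.not_even_iff] at hn
      change OrderDual.toDual (2 * OrderDual.ofDual x.colour - 1) = _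
      rw [hxc, OrderDual.ofDual_toDual]
      congr 1
      omega

/-! ### Hadamard products of the series `W` -/

theorem sum_shuffleWords_chainSum {K : Type*} [Field K] (q : K) (k : ℕ) (a b : ColouredPerm) :
    ((shuffleWords a b).map (chainSum q k (toLex (0, letterOne)))).sum =
      chainSum q k (toLex (0, letterOne)) a.word * chainSum q k (toLex (0, letterOne)) b.word := by
  rw [← chainSum_map q k strictMono_evenLetter a.word 0 letterOne_le_evenLetter,
    ← chainSum_map q k strictMono_oddLetter b.word 0 letterOne_le_oddLetter, chainSum_mul,
    shuffleWords]
  intro z hz hz'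
  obtain ⟨x, -, rfl⟩ := List.mem_map.1 hz
  obtain ⟨y, -, h⟩ := List.mem_map.1 hz'
  exact symbol_evenLetter_ne x y (congrArg Letter.symbol h.symm)

theorem W_shuffle (ε : ℤ) (F G : LabelledConfiguration) (hF : F.f ≠ 0) (hG : G.f ≠ 0) :
    W ε (F.shuffle G hF hG) = hadamard (W ε F) (W ε G) := by
  ext k
  rw [hadamard, PowerSeries.coeff_mk, coeff_W, coeff_W, coeff_W]
  change (shuffleProduct F.f G.f).sum _ = _
  rw [sum_shuffleProduct, Finsupp.sum, Finsupp.sum, Finset.sum_mul_sum]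
  refine Finset.sum_congr rfl fun a _ => Finset.sum_congr rfl fun b _ => ?_
  have h : ((shuffleConfiguration a b).sum fun c n => (n : RatFunc ℚ) *
      (labelProd (mergeLabels F.α G.α) c *
        chainSum (RatFunc.X ^ ε : RatFunc ℚ) k (toLex (0, letterOne)) c.word)) =
      (labelProd F.α a * labelProd G.α b) *
        ((shuffleConfiguration a b).sum fun c n => (n : RatFunc ℚ) *
          chainSum (RatFunc.X ^ ε : RatFunc ℚ) k (toLex (0, letterOne)) c.word) := by
    rw [Finsupp.mul_sum]
    refine Finsupp.sum_congr fun c hc => ?_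
    rw [labelProd_mergeLabels F G a b c (perm_of_mem_support_shuffleConfiguration
      (Finsupp.mem_support_iff.1 hc))]
    ring
  change _ * ((shuffleConfiguration a b).sum fun c n => (n : RatFunc ℚ) *
      (labelProd (mergeLabels F.α G.α) c * _)) = _
  rw [h, sum_shuffleConfiguration, sum_shuffleWords_chainSum]
  ring

theorem W_eq_zero (ε : ℤ) (F : LabelledConfiguration) (hF : F.f = 0) : W ε F = 0 := by
  simp [W, hF]

end ColouredConfig

theorem mainTheorem7 (ε : ℤ) :
    ∀ A ∈ Set.range (ColouredConfig.W ε), ∀ B ∈ Set.range (ColouredConfig.W ε),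
      ColouredConfig.hadamard A B ∈ Set.range (ColouredConfig.W ε) := by
  rintro _ ⟨F, rfl⟩ _ ⟨G, rfl⟩
  -- If either configuration is zero, so is the Hadamard product, and that configuration itself is a
  -- witness.
  by_cases hF : F.f = 0
  · refine ⟨F, ?_⟩
    ext k
    simp [ColouredConfig.hadamard, ColouredConfig.W_eq_zero ε F hF]
  by_cases hG : G.f = 0
  · refine ⟨G, ?_⟩
    ext k
    simp [ColouredConfig.hadamard, ColouredConfig.W_eq_zero ε G hG]
  exact ⟨F.shuffle G hF hG, ColouredConfig.W_shuffle ε F G hF hG⟩
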